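/- Let $p\ge 0$, $C\ge 1$, $\alpha>0$, $\beta>0$, and let $(\kappa_i)_{i\ge1}$ satisfy $C^{-1}i^{-p}\le\kappa_i\le C i^{-p}$ for all $i\ge 1$. For $n\ge1$ and $f\in\ell_2$, let $P^n_f$ be the law of the sequence $Y^n=(Y_1,Y_2,\ldots)$ given by $$Y_i=\kappa_i f_i+\tfrac{1}{\sqrt n}Z_i,\qquad i\ge 1,$$ where $Z_1,Z_2,\ldots$ are independent standard normal random variables. Put on $f$ the product prior $\Pi=\bigotimes_{i\ge1}N(0,i^{-1-2\alpha})$ (which is concentrated on $\ell_2$), and let $\Pi(\cdot\mid Y^n)$ be the posterior distribution, i.e. (any version of) the regular conditional distribution of $f$ given $Y^n$ when $f\sim\Pi$ and $Y^n\mid f\sim P^n_f$. Let $\|f\|=(\sum_i f_i^2)^{1/2}$, and $\|f\|_\beta=(\sum_i f_i^2 i^{2\beta})^{1/2}$ for $f$ in the Sobolev space $S^\beta=\{f\in\ell_2:\|f\|_\beta<\infty\}$. Then for every $R>0$ and every real sequence $M_n\to\infty$, $$\sup_{f_0\in S^\beta,\ \|f_0\|_\beta\le R}\mathbb E_{f_0}\,\Pi\Bigl(f:\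 \|f-f_0\|\ge M_n\, n^{-\frac{\alpha\wedge\beta}{1+2\alpha+2p}}\Bigm| Y^n\Bigr)\longrightarrow 0\qquad (n\to\infty),$$ where $\mathbb E_{f_0}$ denotes expectation over $Y^n\sim P^n_{f_0}$. -/

import Mathlib

open MeasureTheory ProbabilityTheory Filter Topology
open scoped ENNReal NNReal

namespace SeqModel

/-! Sequences `(x₁, x₂, …)` are functions on `ℕ`; the entry `x i` is the mathematical `x_{i+1}`,
so the mathematical index of `x i` is `(i : ℝ) + 1`. -/

/-- The `ℓ₂`-norm `(∑ f_i²)^{1/2}`, with value `∞` outside `ℓ₂`. -/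
noncomputable def ell2Norm (f : ℕ → ℝ) : ℝ≥0∞ :=
  (∑' i, ENNReal.ofReal (f i ^ 2)) ^ (1 / 2 : ℝ)

/-- The Sobolev norm `‖f‖_β = (∑ f_i² i^{2β})^{1/2}`, with value `∞` outside `S^β`. -/
noncomputable def sobolevNorm (β : ℝ) (f : ℕ → ℝ) : ℝ≥0∞ :=
  (∑' i : ℕ, ENNReal.ofReal (f i ^ 2 * ((i : ℝ) + 1) ^ (2 * β))) ^ (1 / 2 : ℝ)

/-- The Sobolev space `S^β`, a subset of `ℓ₂`. -/
def sobolevSpace (β : ℝ) : Set (ℕ → ℝ) :=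
  {f | ell2Norm f < ∞ ∧ sobolevNorm β f < ∞}

/-- The Sobolev ball `{f ∈ S^β : ‖f‖_β ≤ R}`. -/
def sobolevBall (β R : ℝ) : Set (ℕ → ℝ) :=
  {f | f ∈ sobolevSpace β ∧ sobolevNorm β f ≤ ENNReal.ofReal R}

/-- The product prior `⊗ N(0, i^{-1-2α})`. -/
noncomputable def prior (α : ℝ) : Measure (ℕ → ℝ) :=
  Measure.infinitePi fun i : ℕ => gaussianReal 0 (((i : ℝ) + 1) ^ (-1 - 2 * α)).toNNReal

/-- The law of a sequence `Z` of independent standard normal variables. -/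
noncomputable def noise : Measure (ℕ → ℝ) :=
  Measure.infinitePi fun _ : ℕ => gaussianReal 0 1

instance (α : ℝ) : IsProbabilityMeasure (prior α) := by
  unfold prior; infer_instance

instance : IsProbabilityMeasure noise := by
  unfold noise; infer_instance

/-- The observation `Y_i = κ_i f_i + n^{-1/2} Z_i`. -/
noncomputable def observe (κ : ℕ → ℝ) (n : ℕ) (f z : ℕ → ℝ) : ℕ → ℝ :=
  fun i => κ i * f i + 1 / √(n : ℝ) * z i

lemma measurable_observe (κ : ℕ → ℝ) (n : ℕ) :
    Measurable fun q : (ℕ → ℝ) × (ℕ → ℝ) => observe κ n q.1 q.2 := by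
  unfold observe; fun_prop

/-- The statistical model: `sampleLaw κ n f` is the law of the observation `Y` when the parameter
is `f`. -/
noncomputable def sampleLaw (κ : ℕ → ℝ) (n : ℕ) : Kernel (ℕ → ℝ) (ℕ → ℝ) where
  toFun f := noise.map (observe κ n f)
  measurable' := by
    have h : (fun f => noise.map (observe κ n f)) =
        fun f => (noise.map (Prod.mk f)).map
          (fun q : (ℕ → ℝ) × (ℕ → ℝ) => observe κ n q.1 q.2) := by
      funext f
      rw [Measure.map_map (measurable_observe κ n) (by fun_prop)]
      rfl
    rw [h]
    exact (Measure.measurable_map _ (measurable_observe κ n)).comp Measurable.map_prodMk_left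

instance (κ : ℕ → ℝ) (n : ℕ) : IsMarkovKernel (sampleLaw κ n) where
  isProbabilityMeasure f := by
    have : Measurable (observe κ n f) := by unfold observe; fun_prop
    exact Measure.isProbabilityMeasure_map this.aemeasurable

/-- `post` is (a version of) the posterior distribution for the prior `π` and the model `P`:
if `f ∼ π` and `Y | f ∼ P f`, then `post` is a regular conditional distribution of `f` given `Y`.
Here `P ∘ₘ π` is the marginal law of `Y`, and both sides are the joint law of `(Y, f)`. -/
def IsPosterior {Θ 𝓨 : Type*} [MeasurableSpace Θ] [MeasurableSpace 𝓨]
    (π : Measure Θ) (P : Kernel Θ 𝓨) (post : Kernel 𝓨 Θ) : Prop :=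
  (P ∘ₘ π) ⊗ₘ post = (π ⊗ₘ P).map Prod.swap

/-- Posterior distributions exist. -/
lemma isPosterior_posterior (α : ℝ) (κ : ℕ → ℝ) (n : ℕ) :
    IsPosterior (prior α) (sampleLaw κ n) (posterior (sampleLaw κ n) (prior α)) :=
  compProd_posterior_eq_map_swap

end SeqModel

/-!
Conjugacy is coordinatewise. Given `θ_i` with `tan θ_i = √n κ_i σ_i`, where `σ_i²` is the prior
variance of `f_i`, a reflection of the plane of the standardized pair `(f_i / σ_i, Z_i)` preserves
the standard Gaussian law and turns the joint law of `(f, Y)` into that of `Y` followed by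
independent normal variables with means proportional to `Y_i` and variances `σ_i² cos² θ_i`. This
is one version of the posterior. Any other version agrees with it `P_{f₀}`-almost surely: the
shifts of white noise by `ℓ₂` sequences are absolutely continuous (Cameron–Martin, through a
Kakutani-type product criterion), so `P_{f₀}` is absolutely continuous with respect to the
marginal law of `Y`.

The expected squared `ℓ₂`-distance of this posterior to `f₀` is at most the squared bias
`∑ f₀ᵢ² cos⁴ θ_i` plus `2 ∑ σ_i² cos² θ_i`, the variances of the posterior and of its mean. With
`q = 1 + 2α + 2p` and `T = n^{1/q}` one has `cos² θ_i ≲ 1 / (1 + (T / i)^q)`. This makes the bias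
at most a constant times `T^{-2 (α ∧ β)} ‖f₀‖_β²`, and splitting the second sum at `i = T` bounds it
by a constant times `T^{-2α}`. Markov's inequality concludes.
-/

namespace SeqModel

section Kakutani

theorem absolutelyContinuous_of_forall_mem_isSetRing {Ω : Type*} [mΩ : MeasurableSpace Ω]
    {μ ν : Measure Ω} [IsFiniteMeasure μ] [IsFiniteMeasure ν] {𝒞 : Set (Set Ω)}
    (h𝒞 : IsSetRing 𝒞) (huniv : Set.univ ∈ 𝒞) (hgen : mΩ = MeasurableSpace.generateFrom 𝒞)
    {φ : ℝ≥0∞ → ℝ≥0∞} (hφ : Tendsto φ (𝓝 0) (𝓝 0)) (h : ∀ t ∈ 𝒞, ν t ≤ φ (μ t)) :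
    ν ≪ μ := by
  refine Measure.AbsolutelyContinuous.mk fun A hA hμA => ?_
  obtain ⟨ε, -, hε, hε0⟩ := exists_seq_strictAnti_tendsto' (zero_lt_one : (0 : ℝ≥0∞) < 1)
  have happrox (k : ℕ) : ∃ t ∈ 𝒞, (μ + ν) (symmDiff t A) < ε k :=
    exists_measure_symmDiff_lt_of_generateFrom_isSetRing h𝒞
      ⟨{Set.univ}, Set.countable_singleton _, by simpa, by simp⟩ hgen hA (hε k).1
  choose t ht htA using happrox
  have hμt : Tendsto (fun k => μ (t k)) atTop (𝓝 0) := by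
    refine tendsto_of_tendsto_of_tendsto_of_le_of_le tendsto_const_nhds hε0 (fun _ => zero_le)
      fun k => ?_
    calc μ (t k) = μ (t k) - μ A := by rw [hμA, tsub_zero]
      _ ≤ μ (symmDiff (t k) A) := le_measure_symmDiff
      _ ≤ ε k := (Measure.le_add_right le_rfl _).trans (htA k).le
  have hνA (k : ℕ) : ν A ≤ φ (μ (t k)) + ε k :=
    calc ν A ≤ ν (t k) + ν (symmDiff (t k) A) :=
          tsub_le_iff_left.1 (symmDiff_comm A (t k) ▸ le_measure_symmDiff)
      _ ≤ φ (μ (t k)) + ε k :=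
          add_le_add (h _ (ht k)) ((Measure.le_add_left le_rfl _).trans (htA k).le)
  simpa using ge_of_tendsto' ((hφ.comp hμt).add hε0) hνA

variable {ι : Type*} {X : ι → Type*} [∀ i, MeasurableSpace (X i)]

lemma lintegral_pi_prod [Fintype ι] (μ : ∀ i, Measure (X i)) [∀ i, IsProbabilityMeasure (μ i)]
    {d : ∀ i, X i → ℝ≥0∞} (hd : ∀ i, Measurable (d i)) :
    ∫⁻ x, ∏ i, d i (x i) ∂Measure.pi μ = ∏ i, ∫⁻ y, d i y ∂μ i := by
  rw [lintegral_prod_eq_prod_lintegral_of_indepFun Finset.univ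
    (fun i (x : ∀ i, X i) => d i (x i)) (iIndepFun_pi fun i => (hd i).aemeasurable)
    fun i => (hd i).comp (measurable_pi_apply i)]
  exact Finset.prod_congr rfl fun i _ => (measurePreserving_eval μ i).lintegral_comp (hd i)

lemma pi_withDensity [Fintype ι] (μ : ∀ i, Measure (X i)) [∀ i, IsProbabilityMeasure (μ i)]
    {d : ∀ i, X i → ℝ≥0∞} (hd : ∀ i, Measurable (d i))
    [∀ i, SigmaFinite ((μ i).withDensity (d i))] :
    Measure.pi (fun i => (μ i).withDensity (d i)) =
      (Measure.pi μ).withDensity fun x => ∏ i, d i (x i) := by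
  classical
  refine Measure.pi_eq fun s hs => ?_
  have hindicator : (Set.univ.pi s).indicator (fun x : ∀ i, X i => ∏ i, d i (x i)) =
      fun x => ∏ i, (s i).indicator (d i) (x i) := by
    funext x
    simp only [Set.indicator_apply, Set.mem_univ_pi]
    split_ifs with hx
    · simp [hx]
    · obtain ⟨i, hi⟩ := not_forall.1 hx
      exact (Finset.prod_eq_zero (Finset.mem_univ i) (if_neg hi)).symm
  rw [withDensity_apply _ (.univ_pi hs), ← lintegral_indicator (.univ_pi hs), hindicator,
    lintegral_pi_prod μ fun i => (hd i).indicator (hs i)]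
  simp only [lintegral_indicator (hs _), withDensity_apply _ (hs _)]

lemma withDensity_apply_le_sqrt_mul_sqrt {Ω : Type*} [MeasurableSpace Ω] (μ : Measure Ω)
    {D : Ω → ℝ≥0∞} (hD : Measurable D) {S : Set Ω} (hS : MeasurableSet S) :
    μ.withDensity D S ≤ (∫⁻ x, D x ^ 2 ∂μ) ^ (1 / 2 : ℝ) * μ S ^ (1 / 2 : ℝ) := by
  have hHölder := ENNReal.lintegral_mul_le_Lp_mul_Lq (μ.restrict S) Real.HolderConjugate.two_two
    hD.aemeasurable (aemeasurable_const (b := 1))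
  simp only [Pi.mul_apply, mul_one, lintegral_const, one_mul, one_pow,
    Measure.restrict_apply_univ, ENNReal.rpow_two] at hHölder
  rw [withDensity_apply _ hS]
  refine hHölder.trans ?_
  gcongr
  exact Measure.restrict_le_self

theorem infinitePi_withDensity_absolutelyContinuous (μ : ∀ i, Measure (X i))
    [∀ i, IsProbabilityMeasure (μ i)] {d : ∀ i, X i → ℝ≥0∞} (hd : ∀ i, Measurable (d i))
    [∀ i, IsProbabilityMeasure ((μ i).withDensity (d i))] {K : ℝ≥0∞} (hK : K ≠ ∞)
    (hdK : ∀ I : Finset ι, ∏ i ∈ I, ∫⁻ x, d i x ^ 2 ∂μ i ≤ K) :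
    Measure.infinitePi (fun i => (μ i).withDensity (d i)) ≪ Measure.infinitePi μ := by
  have hφ : Tendsto (fun x : ℝ≥0∞ => K ^ (1 / 2 : ℝ) * x ^ (1 / 2 : ℝ)) (𝓝 0) (𝓝 0) := by
    have hsqrt : Tendsto (fun x : ℝ≥0∞ => x ^ (1 / 2 : ℝ)) (𝓝 0) (𝓝 0) := by
      simpa using (ENNReal.continuous_rpow_const (y := (1 / 2 : ℝ))).tendsto 0
    simpa using ENNReal.Tendsto.const_mul hsqrt
      (Or.inr (ENNReal.rpow_ne_top_of_nonneg (by norm_num) hK))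
  refine absolutelyContinuous_of_forall_mem_isSetRing isSetRing_measurableCylinders
    isSetAlgebra_measurableCylinders.univ_mem generateFrom_measurableCylinders.symm hφ
    fun A hA => ?_
  obtain ⟨I, S, hS, rfl⟩ := (mem_measurableCylinders A).1 hA
  rw [Measure.infinitePi_cylinder _ hS, Measure.infinitePi_cylinder _ hS,
    pi_withDensity (fun i : I => μ i) fun i => hd i]
  refine (withDensity_apply_le_sqrt_mul_sqrt _ (by fun_prop) hS).trans ?_
  gcongr
  simp_rw [← Finset.prod_pow]
  rw [lintegral_pi_prod (fun i : I => μ i) fun i => (hd i).pow_const 2,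
    Finset.prod_coe_sort I fun i => ∫⁻ y, d i y ^ 2 ∂μ i]
  exact hdK I

end Kakutani

section ProductSplit

variable {ι : Type*} {X Y : ι → Type*}

lemma pi_eq_pi_piecewise_univ [DecidableEq ι] {s I : Finset ι} (hsI : s ⊆ I) (t : ∀ i, Set (X i)) :
    (s : Set ι).pi t = (I : Set ι).pi (s.piecewise t fun _ => Set.univ) := by
  ext x
  refine ⟨fun hx i _ => ?_, fun hx i hi => by simpa [Finset.mem_coe.1 hi] using hx i (hsI hi)⟩
  by_cases hi : i ∈ s <;> simp [hi, hx i]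

variable [∀ i, MeasurableSpace (X i)] [∀ i, MeasurableSpace (Y i)]

lemma isPiSystem_measurable_squareCylinders :
    IsPiSystem (squareCylinders fun i => {s : Set (X i) | MeasurableSet s}) :=
  isPiSystem_squareCylinders (fun _ => MeasurableSpace.isPiSystem_measurableSet)
    fun _ => MeasurableSet.univ

/-- The whole space, as a constant sequence of square cylinders exhausting a finite measure on a
product; it makes products of such measures accessible to π-system uniqueness. -/
def finiteSpanningSetsInSquareCylinders (ρ : Measure (∀ i, X i)) [IsFiniteMeasure ρ] :
    ρ.FiniteSpanningSetsIn (squareCylinders fun i => {s : Set (X i) | MeasurableSet s}) where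
  set _ := Set.univ
  set_mem _ := ⟨∅, fun _ => Set.univ, fun _ _ => MeasurableSet.univ, by simp⟩
  finite _ := measure_lt_top _ _
  spanning := Set.iUnion_const _

lemma infinitePi_prod_map_unzip (μ : ∀ i, Measure (X i)) (ν : ∀ i, Measure (Y i))
    [∀ i, IsProbabilityMeasure (μ i)] [∀ i, IsProbabilityMeasure (ν i)] :
    (Measure.infinitePi fun i => (μ i).prod (ν i)).map
        (fun q => ((fun i => (q i).1, fun i => (q i).2) : (∀ i, X i) × (∀ i, Y i))) =
      (Measure.infinitePi μ).prod (Measure.infinitePi ν) := by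
  classical
  refine (Measure.prod_eq_generateFrom generateFrom_squareCylinders generateFrom_squareCylinders
    isPiSystem_measurable_squareCylinders isPiSystem_measurable_squareCylinders
    (finiteSpanningSetsInSquareCylinders _) (finiteSpanningSetsInSquareCylinders _) ?_).symm
  rintro _ ⟨s, t, ht, rfl⟩ _ ⟨s', t', ht', rfl⟩
  rw [pi_eq_pi_piecewise_univ (s.subset_union_left (s₂ := s')) t,
    pi_eq_pi_piecewise_univ (s'.subset_union_right (s₁ := s)) t']
  set u := s.piecewise t fun _ => Set.univ
  set u' := s'.piecewise t' fun _ => Set.univ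
  have hu (i : ι) : MeasurableSet (u i) :=
    s.piecewise_cases t _ (fun A => MeasurableSet A) (ht i trivial) .univ
  have hu' (i : ι) : MeasurableSet (u' i) :=
    s'.piecewise_cases t' _ (fun A => MeasurableSet A) (ht' i trivial) .univ
  generalize s ∪ s' = I
  have hpre : (fun q : ∀ i, X i × Y i =>
        ((fun i => (q i).1, fun i => (q i).2) : (∀ i, X i) × (∀ i, Y i))) ⁻¹'
      ((I : Set ι).pi u ×ˢ (I : Set ι).pi u') = (I : Set ι).pi fun i => u i ×ˢ u' i := by
    ext q
    simp only [Set.mem_preimage, Set.mem_prod, Set.mem_pi, forall_and]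
  rw [Measure.map_apply (by fun_prop) ((MeasurableSet.pi I.countable_toSet fun i _ => hu i).prod
      (MeasurableSet.pi I.countable_toSet fun i _ => hu' i)), hpre,
    Measure.infinitePi_pi _ fun i _ => (hu i).prod (hu' i),
    Measure.infinitePi_pi _ fun i _ => hu i, Measure.infinitePi_pi _ fun i _ => hu' i]
  simp_rw [Measure.prod_prod, Finset.prod_mul_distrib]

end ProductSplit

section GaussianShift

lemma gaussianReal_eq_withDensity (h : ℝ) :
    gaussianReal h 1 = (gaussianReal 0 1).withDensity
      fun x => ENNReal.ofReal (Real.exp (h * x - h ^ 2 / 2)) := by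
  rw [gaussianReal_of_var_ne_zero _ one_ne_zero, gaussianReal_of_var_ne_zero _ one_ne_zero,
    ← withDensity_mul _ (measurable_gaussianPDF 0 1) (by fun_prop)]
  congr 1
  funext x
  rw [Pi.mul_apply, gaussianPDF, gaussianPDF, ← ENNReal.ofReal_mul (gaussianPDFReal_nonneg _ _ _),
    gaussianPDFReal, gaussianPDFReal, mul_assoc _ (Real.exp _), ← Real.exp_add]
  congr 3
  push_cast
  ring

lemma lintegral_gaussianReal_exp_sub_sq (h : ℝ) :
    ∫⁻ x, ENNReal.ofReal (Real.exp (h * x - h ^ 2 / 2)) ^ 2 ∂gaussianReal 0 1 =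
      ENNReal.ofReal (Real.exp (h ^ 2)) := by
  have hsq (x : ℝ) : ENNReal.ofReal (Real.exp (h * x - h ^ 2 / 2)) ^ 2 =
      ENNReal.ofReal (Real.exp (-h ^ 2) * Real.exp (2 * h * x)) := by
    rw [← ENNReal.ofReal_pow (Real.exp_pos _).le, ← Real.exp_nat_mul, ← Real.exp_add]
    congr 2
    push_cast
    ring
  have hmgf : ∫ x, Real.exp (2 * h * x) ∂gaussianReal 0 1 = Real.exp (2 * h ^ 2) := by
    have := congrFun (mgf_id_gaussianReal (μ := 0) (v := 1)) (2 * h)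
    simp only [mgf, id, NNReal.coe_one] at this
    rw [this]
    ring_nf
  simp_rw [hsq]
  rw [← ofReal_integral_eq_lintegral_ofReal
      ((integrable_exp_mul_gaussianReal (2 * h)).const_mul _)
      (ae_of_all _ fun x => by positivity),
    integral_const_mul, hmgf, ← Real.exp_add]
  ring_nf

theorem noise_map_add_absolutelyContinuous {h : ℕ → ℝ} (hh : Summable fun i => h i ^ 2) :
    noise.map (fun z i => z i + h i) ≪ noise := by
  set d : ℕ → ℝ → ℝ≥0∞ := fun i x => ENNReal.ofReal (Real.exp (h i * x - h i ^ 2 / 2))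
  have hd (i : ℕ) : (gaussianReal 0 1).withDensity (d i) = gaussianReal (h i) 1 :=
    (gaussianReal_eq_withDensity (h i)).symm
  have (i : ℕ) : IsProbabilityMeasure ((gaussianReal 0 1).withDensity (d i)) := by
    rw [hd]; infer_instance
  have hmap : noise.map (fun z i => z i + h i) =
      Measure.infinitePi fun i => (gaussianReal 0 1).withDensity (d i) := by
    rw [noise, Measure.infinitePi_map_pi _ (f := fun i x => x + h i) fun i => by fun_prop]
    simp only [gaussianReal_map_add_const, zero_add, hd]
  rw [hmap]
  refine infinitePi_withDensity_absolutelyContinuous _ (fun i => by fun_prop)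
    (K := ENNReal.ofReal (Real.exp (∑' i, h i ^ 2))) ENNReal.ofReal_ne_top fun I => ?_
  simp_rw [d, lintegral_gaussianReal_exp_sub_sq]
  rw [← ENNReal.ofReal_prod_of_nonneg fun i _ => (Real.exp_pos _).le, ← Real.exp_sum]
  gcongr
  exact hh.sum_le_tsum I fun i _ => sq_nonneg _

theorem sampleLaw_absolutelyContinuous {κ f g : ℕ → ℝ} {n : ℕ} (hn : 0 < n)
    (hfg : Summable fun i => (κ i * (f i - g i)) ^ 2) :
    sampleLaw κ n f ≪ sampleLaw κ n g := by
  have hg : Measurable (observe κ n g) := by unfold observe; fun_prop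
  have hsum : Summable fun i => (√(n : ℝ) * (κ i * (f i - g i))) ^ 2 := by
    simpa only [mul_pow] using hfg.mul_left (√(n : ℝ) ^ 2)
  have hshift : observe κ n f =
      observe κ n g ∘ fun z i => z i + √(n : ℝ) * (κ i * (f i - g i)) := by
    funext z i
    simp only [observe, Function.comp_apply]
    field_simp
    ring
  calc sampleLaw κ n f = (noise.map _).map (observe κ n g) := by
        rw [Measure.map_map hg (by fun_prop), ← hshift]; rfl
    _ ≪ sampleLaw κ n g := (noise_map_add_absolutelyContinuous hsum).map hg

end GaussianShift

section SecondMoments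

lemma lintegral_sq_gaussianReal (m : ℝ) (v : ℝ≥0) :
    ∫⁻ x, ENNReal.ofReal (x ^ 2) ∂gaussianReal m v = ENNReal.ofReal (m ^ 2 + v) := by
  have hmoment := variance_eq_sub (memLp_id_gaussianReal (μ := m) (v := v) 2)
  simp only [variance_id_gaussianReal, Pi.pow_apply, id_eq, integral_id_gaussianReal] at hmoment
  have hint : Integrable (fun x => x ^ 2) (gaussianReal m v) :=
    (memLp_id_gaussianReal 2).integrable_sq
  rw [← ofReal_integral_eq_lintegral_ofReal hint (ae_of_all _ fun x => sq_nonneg x), hmoment,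
    add_sub_cancel]

lemma noise_map_affine_eval (u s : ℝ) (i : ℕ) :
    noise.map (fun z => u + s * z i) = gaussianReal u (s ^ 2).toNNReal := by
  have heval : noise.map (Function.eval i) = gaussianReal 0 1 := Measure.infinitePi_map_eval _ i
  have hcomp : (fun z : ℕ → ℝ => u + s * z i) = (u + ·) ∘ (s * ·) ∘ Function.eval i := rfl
  rw [hcomp, ← Measure.map_map (by fun_prop) (by fun_prop),
    ← Measure.map_map (by fun_prop) (by fun_prop), heval, gaussianReal_map_const_mul,
    gaussianReal_map_const_add, mul_zero, zero_add, mul_one]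
  congr 1
  ext
  simp [sq_nonneg]

lemma lintegral_noise_affine_sq (u s : ℝ) (i : ℕ) :
    ∫⁻ z, ENNReal.ofReal ((u + s * z i) ^ 2) ∂noise = ENNReal.ofReal (u ^ 2 + s ^ 2) := by
  calc ∫⁻ z, ENNReal.ofReal ((u + s * z i) ^ 2) ∂noise
      = ∫⁻ x, ENNReal.ofReal (x ^ 2) ∂noise.map fun z => u + s * z i :=
        (lintegral_map (f := fun x => ENNReal.ofReal (x ^ 2)) (by fun_prop) (by fun_prop)).symm
    _ = ENNReal.ofReal (u ^ 2 + s ^ 2) := by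
        rw [noise_map_affine_eval, lintegral_sq_gaussianReal, Real.coe_toNNReal _ (sq_nonneg s)]

end SecondMoments

section ScaledNoise

/-- The law `⊗ N(0, σ_i²)` of the sequence `(σ_i Z_i)`, with `Z` standard white noise. -/
noncomputable def scaledNoise (σ : ℕ → ℝ) : Measure (ℕ → ℝ) :=
  noise.map fun z i => σ i * z i

instance (σ : ℕ → ℝ) : IsProbabilityMeasure (scaledNoise σ) :=
  Measure.isProbabilityMeasure_map (Measurable.aemeasurable (by fun_prop))

/-- The prior standard deviation of the coordinate with mathematical index `i + 1`. -/
noncomputable def priorSd (α : ℝ) (i : ℕ) : ℝ := ((i : ℝ) + 1) ^ (-1 / 2 - α)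

lemma priorSd_sq (α : ℝ) (i : ℕ) : priorSd α i ^ 2 = ((i : ℝ) + 1) ^ (-1 - 2 * α) := by
  rw [priorSd, ← Real.rpow_natCast, ← Real.rpow_mul (by positivity)]
  congr 1
  push_cast
  ring

lemma prior_eq_scaledNoise (α : ℝ) : prior α = scaledNoise (priorSd α) := by
  rw [scaledNoise, noise,
    Measure.infinitePi_map_pi _ (f := fun i x => priorSd α i * x) fun i => by fun_prop, prior]
  congr 1
  funext i
  rw [gaussianReal_map_const_mul, mul_zero, mul_one, ← priorSd_sq]
  congr 1
  ext
  simp [sq_nonneg]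

lemma summable_priorSd_sq {α : ℝ} (hα : 0 < α) : Summable fun i => priorSd α i ^ 2 := by
  simp_rw [priorSd_sq]
  have hsum : Summable fun i : ℕ => (i : ℝ) ^ (-1 - 2 * α) :=
    Real.summable_nat_rpow.2 (by linarith)
  exact_mod_cast (summable_nat_add_iff 1).2 hsum

lemma summable_sq_of_tsum_ofReal_ne_top {f : ℕ → ℝ} (hf : ∑' i, ENNReal.ofReal (f i ^ 2) ≠ ∞) :
    Summable fun i => f i ^ 2 := by
  simpa only [ENNReal.toReal_ofReal (sq_nonneg _)] using ENNReal.summable_toReal hf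

lemma ae_scaledNoise_summable_sq {σ : ℕ → ℝ} (hσ : Summable fun i => σ i ^ 2) :
    ∀ᵐ f ∂scaledNoise σ, Summable fun i => f i ^ 2 := by
  have hmeas : Measurable fun f : ℕ → ℝ => ∑' i, ENNReal.ofReal (f i ^ 2) :=
    Measurable.tsum fun i => by fun_prop
  have hmean : ∫⁻ f, ∑' i, ENNReal.ofReal (f i ^ 2) ∂scaledNoise σ =
      ∑' i, ENNReal.ofReal (σ i ^ 2) := by
    rw [scaledNoise, lintegral_map hmeas (by fun_prop),
      lintegral_tsum fun i => Measurable.aemeasurable (by fun_prop)]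
    exact tsum_congr fun i => by simpa using lintegral_noise_affine_sq 0 (σ i) i
  filter_upwards [ae_lt_top hmeas (hmean ▸ hσ.tsum_ofReal_ne_top)] with f hf
  exact summable_sq_of_tsum_ofReal_ne_top hf.ne

end ScaledNoise

section Marginal

lemma absolutelyContinuous_comp_of_ae {Θ 𝓨 : Type*} [MeasurableSpace Θ] [MeasurableSpace 𝓨]
    {π : Measure Θ} [NeZero π] {P : Kernel Θ 𝓨} {μ : Measure 𝓨}
    (h : ∀ᵐ θ ∂π, μ ≪ P θ) : μ ≪ P ∘ₘ π := by
  refine Measure.AbsolutelyContinuous.mk fun A hA hA0 => ?_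
  rw [Measure.bind_apply hA P.aemeasurable, lintegral_eq_zero_iff (P.measurable_coe hA)] at hA0
  obtain ⟨θ, hθA, hθ⟩ := (hA0.and h).exists
  exact hθ hθA

lemma summable_mul_sub_sq {κ f g : ℕ → ℝ} {B : ℝ} (hκ : ∀ i, |κ i| ≤ B)
    (hf : Summable fun i => f i ^ 2) (hg : Summable fun i => g i ^ 2) :
    Summable fun i => (κ i * (f i - g i)) ^ 2 := by
  refine .of_nonneg_of_le (fun i => sq_nonneg _) (fun i => ?_) ((hf.add hg).mul_left (2 * B ^ 2))
  calc (κ i * (f i - g i)) ^ 2 = |κ i| ^ 2 * (f i - g i) ^ 2 := by rw [mul_pow, sq_abs]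
    _ ≤ B ^ 2 * (2 * (f i ^ 2 + g i ^ 2)) := by
        gcongr
        · exact hκ i
        · linarith [sq_nonneg (f i + g i)]
    _ = 2 * B ^ 2 * (f i ^ 2 + g i ^ 2) := by ring

theorem sampleLaw_absolutelyContinuous_marginal {σ κ f₀ : ℕ → ℝ} {B : ℝ} {n : ℕ} (hn : 0 < n)
    (hκ : ∀ i, |κ i| ≤ B) (hσ : Summable fun i => σ i ^ 2) (hf₀ : Summable fun i => f₀ i ^ 2) :
    sampleLaw κ n f₀ ≪ sampleLaw κ n ∘ₘ scaledNoise σ :=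
  absolutelyContinuous_comp_of_ae <| (ae_scaledNoise_summable_sq hσ).mono fun _ hf =>
    sampleLaw_absolutelyContinuous hn (summable_mul_sub_sq hκ hf₀ hf)

end Marginal

section Conjugacy

lemma gaussianReal_prod_map_reflection (θ : ℝ) :
    ((gaussianReal 0 1).prod (gaussianReal 0 1)).map
        (fun q => (Real.sin θ * q.1 + Real.cos θ * q.2, Real.cos θ * q.1 - Real.sin θ * q.2)) =
      (gaussianReal 0 1).prod (gaussianReal 0 1) := by
  have hcomp : (fun q : ℝ × ℝ =>
        (Real.sin θ * q.1 + Real.cos θ * q.2, Real.cos θ * q.1 - Real.sin θ * q.2)) =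
      ContinuousLinearMap.rotation θ ∘ Prod.swap := by
    funext q
    simp [ContinuousLinearMap.rotation_apply, add_comm, sub_eq_add_neg]
  rw [hcomp, ← Measure.map_map (by fun_prop) measurable_swap, Measure.prod_swap]
  exact IsGaussian.map_rotation_eq_self (by simp) θ

lemma noise_prod_map_reflection (θ : ℕ → ℝ) :
    (noise.prod noise).map (fun q =>
        ((fun i => Real.sin (θ i) * q.1 i + Real.cos (θ i) * q.2 i,
          fun i => Real.cos (θ i) * q.1 i - Real.sin (θ i) * q.2 i) : (ℕ → ℝ) × (ℕ → ℝ))) =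
      noise.prod noise := by
  unfold noise
  have hunzip := infinitePi_prod_map_unzip (fun _ : ℕ => gaussianReal 0 1)
    fun _ : ℕ => gaussianReal 0 1
  have hreflect := Measure.infinitePi_map_pi
    (fun _ : ℕ => (gaussianReal 0 1).prod (gaussianReal 0 1))
    (f := fun i q => (Real.sin (θ i) * q.1 + Real.cos (θ i) * q.2,
      Real.cos (θ i) * q.1 - Real.sin (θ i) * q.2)) fun i => by fun_prop
  simp_rw [gaussianReal_prod_map_reflection] at hreflect
  conv_rhs => rw [← hunzip, ← hreflect]
  rw [← hunzip, Measure.map_map (by fun_prop) (by fun_prop),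
    Measure.map_map (by fun_prop) (by fun_prop)]
  rfl

/-- The kernel sending `y` to the law `⊗ N(c_i y_i, s_i²)` of `(c_i y_i + s_i W_i)`, with `W` white
noise: the shape of both the sampling law and the conjugate posterior. -/
noncomputable def affineKernel (c s : ℕ → ℝ) : Kernel (ℕ → ℝ) (ℕ → ℝ) :=
  (Kernel.id ×ₖ Kernel.const _ noise).map fun q i => c i * q.1 i + s i * q.2 i

instance (c s : ℕ → ℝ) : IsMarkovKernel (affineKernel c s) :=
  Kernel.IsMarkovKernel.map _ (by fun_prop)

lemma affineKernel_apply (c s y : ℕ → ℝ) :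
    affineKernel c s y = noise.map fun w i => c i * y i + s i * w i := by
  rw [affineKernel, Kernel.map_apply _ (by fun_prop), Kernel.prod_apply, Kernel.id_apply,
    Kernel.const_apply, Measure.dirac_prod, Measure.map_map (by fun_prop) (by fun_prop)]
  rfl

lemma sampleLaw_eq_affineKernel (κ : ℕ → ℝ) (n : ℕ) :
    sampleLaw κ n = affineKernel κ fun _ => 1 / √(n : ℝ) :=
  Kernel.ext fun f => (affineKernel_apply κ _ f).symm

lemma scaledNoise_compProd_affineKernel (σ c s : ℕ → ℝ) :
    scaledNoise σ ⊗ₘ affineKernel c s = (noise.prod noise).map fun q =>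
      (fun i => σ i * q.1 i, fun i => c i * (σ i * q.1 i) + s i * q.2 i) := by
  refine Measure.ext_of_lintegral _ fun g hg => ?_
  rw [Measure.lintegral_compProd hg, scaledNoise,
    lintegral_map hg.lintegral_kernel_prod_right' (by fun_prop), lintegral_map hg (by fun_prop),
    lintegral_prod _ (by fun_prop)]
  refine lintegral_congr fun x => ?_
  rw [affineKernel_apply, lintegral_map (by fun_prop) (by fun_prop)]

/-- The angle `θ_i` with tangent `√n κ_i σ_i`, the signal-to-noise ratio of the `i`th coordinate:
in the plane of the standardized pair `(f_i / σ_i, Z_i)` it gives the direction of `Y_i`. -/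
noncomputable def signalAngle (κ σ : ℕ → ℝ) (n i : ℕ) : ℝ :=
  Real.arctan (√(n : ℝ) * (κ i * σ i))

/-- The factor multiplying `Y_i` in the posterior mean of `f_i` under the prior `⊗ N(0, σ_i²)`. -/
noncomputable def posteriorGain (κ σ : ℕ → ℝ) (n i : ℕ) : ℝ :=
  √(n : ℝ) * σ i * (Real.sin (signalAngle κ σ n i) * Real.cos (signalAngle κ σ n i))

/-- The posterior standard deviation of `f_i` under the prior `⊗ N(0, σ_i²)`, up to sign. -/
noncomputable def posteriorSd (κ σ : ℕ → ℝ) (n i : ℕ) : ℝ :=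
  σ i * Real.cos (signalAngle κ σ n i)

lemma cos_signalAngle_pos (κ σ : ℕ → ℝ) (n i : ℕ) : 0 < Real.cos (signalAngle κ σ n i) :=
  Real.cos_arctan_pos _

lemma sin_signalAngle (κ σ : ℕ → ℝ) (n i : ℕ) :
    Real.sin (signalAngle κ σ n i) =
      √(n : ℝ) * (κ i * σ i) * Real.cos (signalAngle κ σ n i) := by
  rw [← Real.tan_mul_cos (cos_signalAngle_pos κ σ n i).ne', signalAngle, Real.tan_arctan]

lemma scaledNoise_compProd_sampleLaw_map_swap (κ σ : ℕ → ℝ) {n : ℕ} (hn : 0 < n) :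
    (scaledNoise σ ⊗ₘ sampleLaw κ n).map Prod.swap =
      scaledNoise (fun i => (√(n : ℝ) * Real.cos (signalAngle κ σ n i))⁻¹) ⊗ₘ
        affineKernel (posteriorGain κ σ n) (posteriorSd κ σ n) := by
  rw [sampleLaw_eq_affineKernel, scaledNoise_compProd_affineKernel,
    scaledNoise_compProd_affineKernel, Measure.map_map measurable_swap (by fun_prop)]
  conv_rhs => rw [← noise_prod_map_reflection (signalAngle κ σ n)]
  rw [Measure.map_map (by fun_prop) (by fun_prop)]
  congr 1
  funext q
  have hcos (i : ℕ) := (cos_signalAngle_pos κ σ n i).ne'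
  refine Prod.ext (funext fun i => ?_) (funext fun i => ?_)
  · simp only [Function.comp_apply, Prod.fst_swap, sin_signalAngle]
    field_simp [hcos i]
  · have hpyth := Real.sin_sq_add_cos_sq (signalAngle κ σ n i)
    simp only [Function.comp_apply, Prod.snd_swap, posteriorGain, posteriorSd]
    field_simp [hcos i]
    linear_combination (-(σ i) * q.1 i) * hpyth

theorem isPosterior_affineKernel (κ σ : ℕ → ℝ) {n : ℕ} (hn : 0 < n) :
    IsPosterior (scaledNoise σ) (sampleLaw κ n)
      (affineKernel (posteriorGain κ σ n) (posteriorSd κ σ n)) := by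
  have hjoint := scaledNoise_compProd_sampleLaw_map_swap κ σ hn
  have hmarginal := congrArg Measure.fst hjoint
  rw [Measure.fst_map_swap, Measure.snd_compProd, Measure.fst_compProd] at hmarginal
  rw [IsPosterior, hjoint, hmarginal]

lemma IsPosterior.ae_eq {Θ 𝓨 : Type*} [MeasurableSpace Θ] [MeasurableSpace 𝓨]
    [MeasurableSpace.CountableOrCountablyGenerated 𝓨 Θ]
    {π : Measure Θ} [IsFiniteMeasure π] {P : Kernel Θ 𝓨} [IsFiniteKernel P]
    {post post' : Kernel 𝓨 Θ} [IsFiniteKernel post] [IsFiniteKernel post']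
    (h : IsPosterior π P post) (h' : IsPosterior π P post') : post =ᵐ[P ∘ₘ π] post' :=
  Kernel.ae_eq_of_compProd_eq (Eq.trans h (Eq.symm h'))

end Conjugacy

section PosteriorRisk

lemma ell2Norm_sq (f : ℕ → ℝ) : ell2Norm f ^ 2 = ∑' i, ENNReal.ofReal (f i ^ 2) := by
  rw [ell2Norm, ← ENNReal.rpow_two, ← ENNReal.rpow_mul]
  norm_num

lemma sobolevNorm_sq (β : ℝ) (f : ℕ → ℝ) :
    sobolevNorm β f ^ 2 = ∑' i : ℕ, ENNReal.ofReal (f i ^ 2 * ((i : ℝ) + 1) ^ (2 * β)) := by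
  rw [sobolevNorm, ← ENNReal.rpow_two, ← ENNReal.rpow_mul]
  norm_num

lemma summable_sq_of_ell2Norm_ne_top {f : ℕ → ℝ} (hf : ell2Norm f ≠ ∞) :
    Summable fun i => f i ^ 2 :=
  summable_sq_of_tsum_ofReal_ne_top (ell2Norm_sq f ▸ ENNReal.pow_ne_top hf)

lemma measurable_ell2Norm : Measurable ell2Norm := by
  unfold ell2Norm; fun_prop

lemma measure_le_ell2Norm_sub_le (ρ : Measure (ℕ → ℝ)) (f₀ : ℕ → ℝ) {r : ℝ≥0∞} (hr₀ : r ≠ 0)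
    (hr : r ≠ ∞) :
    ρ {f | r ≤ ell2Norm (f - f₀)} ≤ (∫⁻ f, ell2Norm (f - f₀) ^ 2 ∂ρ) / r ^ 2 := by
  have hmeas : Measurable fun f => ell2Norm (f - f₀) ^ 2 :=
    (measurable_ell2Norm.comp (measurable_id.sub_const f₀)).pow_const 2
  refine (measure_mono fun f hf => ?_).trans (meas_ge_le_lintegral_div hmeas.aemeasurable
    (pow_ne_zero 2 hr₀) (ENNReal.pow_ne_top hr))
  exact pow_le_pow_left₀ zero_le (Set.mem_ofPred.1 hf) 2

lemma lintegral_affineKernel_sq (c s κ f₀ : ℕ → ℝ) (n i : ℕ) :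
    ∫⁻ Y, ∫⁻ f, ENNReal.ofReal ((f i - f₀ i) ^ 2) ∂affineKernel c s Y ∂sampleLaw κ n f₀ =
      ENNReal.ofReal (((c i * κ i - 1) * f₀ i) ^ 2 + (c i * (1 / √(n : ℝ))) ^ 2) +
        ENNReal.ofReal (s i ^ 2) := by
  have hinner (Y : ℕ → ℝ) : ∫⁻ f, ENNReal.ofReal ((f i - f₀ i) ^ 2) ∂affineKernel c s Y =
      ENNReal.ofReal ((c i * Y i - f₀ i) ^ 2) + ENNReal.ofReal (s i ^ 2) := by
    rw [affineKernel_apply, lintegral_map (by fun_prop) (by fun_prop),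
      ← ENNReal.ofReal_add (sq_nonneg _) (sq_nonneg _), ← lintegral_noise_affine_sq _ _ i]
    simp_rw [add_sub_right_comm]
  simp_rw [hinner]
  rw [lintegral_add_right _ measurable_const, lintegral_const, measure_univ, mul_one,
    sampleLaw_eq_affineKernel, affineKernel_apply, lintegral_map (by fun_prop) (by fun_prop),
    ← lintegral_noise_affine_sq _ _ i]
  ring_nf

theorem lintegral_affineKernel_ell2Norm_sub_sq (c s κ f₀ : ℕ → ℝ) (n : ℕ) :
    ∫⁻ Y, ∫⁻ f, ell2Norm (f - f₀) ^ 2 ∂affineKernel c s Y ∂sampleLaw κ n f₀ =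
      ∑' i, (ENNReal.ofReal (((c i * κ i - 1) * f₀ i) ^ 2 + (c i * (1 / √(n : ℝ))) ^ 2) +
        ENNReal.ofReal (s i ^ 2)) := by
  have hmeas (i : ℕ) : Measurable fun f : ℕ → ℝ => ENNReal.ofReal ((f i - f₀ i) ^ 2) := by
    fun_prop
  simp_rw [ell2Norm_sq, Pi.sub_apply, lintegral_tsum fun i => (hmeas i).aemeasurable]
  rw [lintegral_tsum fun i => (hmeas i).lintegral_kernel.aemeasurable]
  simp_rw [lintegral_affineKernel_sq]

lemma posteriorGain_mul_sub_one (κ σ : ℕ → ℝ) (n i : ℕ) :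
    posteriorGain κ σ n i * κ i - 1 = -Real.cos (signalAngle κ σ n i) ^ 2 := by
  rw [posteriorGain]
  linear_combination Real.sin_sq_add_cos_sq (signalAngle κ σ n i) -
    Real.sin (signalAngle κ σ n i) * sin_signalAngle κ σ n i

lemma posteriorGain_div_sqrt_sq_le (κ σ : ℕ → ℝ) {n : ℕ} (hn : 0 < n) (i : ℕ) :
    (posteriorGain κ σ n i * (1 / √(n : ℝ))) ^ 2 ≤
      Real.cos (signalAngle κ σ n i) ^ 2 * σ i ^ 2 :=
  calc (posteriorGain κ σ n i * (1 / √(n : ℝ))) ^ 2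
      = Real.sin (signalAngle κ σ n i) ^ 2 * (Real.cos (signalAngle κ σ n i) ^ 2 * σ i ^ 2) := by
        rw [posteriorGain]; field_simp
    _ ≤ Real.cos (signalAngle κ σ n i) ^ 2 * σ i ^ 2 :=
        mul_le_of_le_one_left (by positivity) (Real.sin_sq_le_one _)

theorem lintegral_posterior_ell2Norm_sub_sq_le (κ σ f₀ : ℕ → ℝ) {n : ℕ} (hn : 0 < n) :
    ∫⁻ Y, ∫⁻ f, ell2Norm (f - f₀) ^ 2 ∂affineKernel (posteriorGain κ σ n) (posteriorSd κ σ n) Y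
        ∂sampleLaw κ n f₀ ≤
      ∑' i, ENNReal.ofReal ((Real.cos (signalAngle κ σ n i) ^ 2 * f₀ i) ^ 2) +
        2 * ∑' i, ENNReal.ofReal (Real.cos (signalAngle κ σ n i) ^ 2 * σ i ^ 2) := by
  rw [lintegral_affineKernel_ell2Norm_sub_sq, ← ENNReal.tsum_mul_left, ← ENNReal.tsum_add]
  refine ENNReal.tsum_le_tsum fun i => ?_
  have hsampling := posteriorGain_div_sqrt_sq_le κ σ hn i
  have hposterior : posteriorSd κ σ n i ^ 2 = Real.cos (signalAngle κ σ n i) ^ 2 * σ i ^ 2 := by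
    rw [posteriorSd]; ring
  rw [posteriorGain_mul_sub_one, neg_mul, neg_sq, hposterior,
    ENNReal.ofReal_add (by positivity) (by positivity), add_assoc, two_mul]
  gcongr

theorem lintegral_posterior_le {κ σ f₀ : ℕ → ℝ} {B : ℝ} {n : ℕ} (hn : 0 < n) (hκ : ∀ i, |κ i| ≤ B)
    (hσ : Summable fun i => σ i ^ 2) (hf₀ : ell2Norm f₀ ≠ ∞)
    {post : Kernel (ℕ → ℝ) (ℕ → ℝ)} [IsFiniteKernel post]
    (hpost : IsPosterior (scaledNoise σ) (sampleLaw κ n) post)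
    {r : ℝ≥0∞} (hr₀ : r ≠ 0) (hr : r ≠ ∞) :
    ∫⁻ Y, post Y {f | r ≤ ell2Norm (f - f₀)} ∂sampleLaw κ n f₀ ≤
      (∑' i, ENNReal.ofReal ((Real.cos (signalAngle κ σ n i) ^ 2 * f₀ i) ^ 2) +
        2 * ∑' i, ENNReal.ofReal (Real.cos (signalAngle κ σ n i) ^ 2 * σ i ^ 2)) / r ^ 2 := by
  set conj := affineKernel (posteriorGain κ σ n) (posteriorSd κ σ n)
  have hac := sampleLaw_absolutelyContinuous_marginal hn hκ hσ (summable_sq_of_ell2Norm_ne_top hf₀)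
  have hconj : post =ᵐ[sampleLaw κ n f₀] conj :=
    hac.ae_le (hpost.ae_eq (isPosterior_affineKernel κ σ hn))
  calc ∫⁻ Y, post Y {f | r ≤ ell2Norm (f - f₀)} ∂sampleLaw κ n f₀
      = ∫⁻ Y, conj Y {f | r ≤ ell2Norm (f - f₀)} ∂sampleLaw κ n f₀ :=
        lintegral_congr_ae (hconj.mono fun Y hY => by simp only [hY])
    _ ≤ ∫⁻ Y, (∫⁻ f, ell2Norm (f - f₀) ^ 2 ∂conj Y) * (r ^ 2)⁻¹ ∂sampleLaw κ n f₀ :=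
        lintegral_mono fun Y => measure_le_ell2Norm_sub_le (conj Y) f₀ hr₀ hr
    _ = (∫⁻ Y, ∫⁻ f, ell2Norm (f - f₀) ^ 2 ∂conj Y ∂sampleLaw κ n f₀) / r ^ 2 := by
        rw [lintegral_mul_const' _ _ (ENNReal.inv_ne_top.2 (pow_ne_zero 2 hr₀)), div_eq_mul_inv]
    _ ≤ _ := by
        gcongr
        exact lintegral_posterior_ell2Norm_sub_sq_le κ σ f₀ hn

end PosteriorRisk

section Rates

lemma sum_range_add_rpow_le {a : ℝ} (ha : 0 < a) {m : ℕ} (hm : 0 < m) (N : ℕ) :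
    ∑ k ∈ Finset.range N, (((k + m : ℕ) : ℝ) + 1) ^ (-1 - a) ≤ (m : ℝ) ^ (-a) / a := by
  have hm₀ : (0 : ℝ) < m := by exact_mod_cast hm
  have hanti : AntitoneOn (fun x : ℝ => x ^ (-1 - a)) (Set.Icc (m : ℝ) (m + N)) :=
    fun x hx y _ hxy => Real.rpow_le_rpow_of_nonpos (hm₀.trans_le hx.1) hxy (by linarith)
  have hzero : (0 : ℝ) ∉ Set.uIcc (m : ℝ) (m + N) := by
    rw [Set.uIcc_of_le (by linarith [(N.cast_nonneg : (0 : ℝ) ≤ N)])]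
    exact fun h => hm₀.not_ge h.1
  calc ∑ k ∈ Finset.range N, (((k + m : ℕ) : ℝ) + 1) ^ (-1 - a)
      = ∑ k ∈ Finset.range N, ((m : ℝ) + (k + 1 : ℕ)) ^ (-1 - a) := by
        refine Finset.sum_congr rfl fun k _ => ?_
        push_cast
        ring_nf
    _ ≤ ∫ x in (m : ℝ)..m + N, x ^ (-1 - a) := hanti.sum_le_integral
    _ = ((m : ℝ) ^ (-a) - ((m : ℝ) + N) ^ (-a)) / a := by
        rw [integral_rpow (Or.inr ⟨by linarith, hzero⟩)]
        ring_nf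
    _ ≤ (m : ℝ) ^ (-a) / a := by
        gcongr
        exact sub_le_self _ (by positivity)

lemma rpow_div_one_add_le_of_le {a q T j : ℝ} (hq : 1 + a ≤ q) (hj : 0 < j) (hjT : j ≤ T) :
    j ^ (-1 - a) / (1 + (T / j) ^ q) ≤ T ^ (-1 - a) := by
  have hT : 0 < T := hj.trans_le hjT
  have hj_eq : j ^ (-1 - a) = T ^ (-1 - a) * (T / j) ^ (1 + a) := by
    rw [Real.div_rpow hT.le hj.le, ← mul_div_assoc, ← Real.rpow_add hT, ← neg_add',
      Real.rpow_neg hj.le]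
    simp
  rw [div_le_iff₀ (by positivity), hj_eq]
  gcongr
  calc (T / j) ^ (1 + a) ≤ (T / j) ^ q :=
        Real.rpow_le_rpow_of_exponent_le ((one_le_div hj).2 hjT) hq
    _ ≤ 1 + (T / j) ^ q := by linarith

lemma sum_range_rpow_div_one_add_le {a q T : ℝ} (hq : 1 + a ≤ q) (hT : 0 < T) {m : ℕ}
    (hmT : m ≤ T) :
    ∑ i ∈ Finset.range m, ((i : ℝ) + 1) ^ (-1 - a) / (1 + (T / ((i : ℝ) + 1)) ^ q) ≤ T ^ (-a) :=
  calc ∑ i ∈ Finset.range m, ((i : ℝ) + 1) ^ (-1 - a) / (1 + (T / ((i : ℝ) + 1)) ^ q)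
      ≤ ∑ _i ∈ Finset.range m, T ^ (-1 - a) :=
        Finset.sum_le_sum fun i hi => rpow_div_one_add_le_of_le hq (by positivity)
          (le_trans (by exact_mod_cast Finset.mem_range.1 hi) hmT)
    _ = m * T ^ (-1 - a) := by simp
    _ ≤ T * T ^ (-1 - a) := by gcongr
    _ = T ^ (-a) := by
        rw [show -a = 1 + (-1 - a) by ring, Real.rpow_add hT, Real.rpow_one]

theorem tsum_rpow_div_one_add_le {a q T : ℝ} (ha : 0 < a) (hq : 1 + a ≤ q) (hT : 1 ≤ T) :
    ∑' i : ℕ, ENNReal.ofReal (((i : ℝ) + 1) ^ (-1 - a) / (1 + (T / ((i : ℝ) + 1)) ^ q)) ≤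
      ENNReal.ofReal ((1 + 2 ^ a / a) * T ^ (-a)) := by
  have hT₀ : 0 < T := one_pos.trans_le hT
  set m := ⌊T⌋₊
  have hm : 0 < m := Nat.floor_pos.2 hT
  have hTm : T / 2 ≤ m := by
    have hm₁ : (1 : ℝ) ≤ m := by exact_mod_cast hm
    linarith [Nat.lt_floor_add_one T]
  set w : ℕ → ℝ := fun i => ((i : ℝ) + 1) ^ (-1 - a) / (1 + (T / ((i : ℝ) + 1)) ^ q)
  have hw (i : ℕ) : 0 ≤ w i := by positivity
  have htail (N : ℕ) : ∑ k ∈ Finset.range N, w (k + m) ≤ 2 ^ a / a * T ^ (-a) :=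
    calc ∑ k ∈ Finset.range N, w (k + m)
        ≤ ∑ k ∈ Finset.range N, (((k + m : ℕ) : ℝ) + 1) ^ (-1 - a) :=
          Finset.sum_le_sum fun k _ => div_le_self (by positivity)
            (le_add_of_nonneg_right (by positivity))
      _ ≤ (m : ℝ) ^ (-a) / a := sum_range_add_rpow_le ha hm N
      _ ≤ (T / 2) ^ (-a) / a := by
          gcongr ?_ / a
          exact Real.rpow_le_rpow_of_nonpos (by positivity) hTm (by linarith)
      _ = 2 ^ a / a * T ^ (-a) := by
          rw [Real.div_rpow hT₀.le zero_le_two, Real.rpow_neg zero_le_two]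
          field_simp
  rw [add_mul, one_mul, ENNReal.ofReal_add (by positivity) (by positivity),
    ← ENNReal.summable.sum_add_tsum_nat_add' (k := m),
    ← ENNReal.ofReal_sum_of_nonneg fun i _ => hw i]
  gcongr
  · exact sum_range_rpow_div_one_add_le hq hT₀ (Nat.floor_le hT₀.le)
  · refine ENNReal.tsum_le_of_sum_range_le fun N => ?_
    rw [← ENNReal.ofReal_sum_of_nonneg fun k _ => hw (k + m)]
    exact ENNReal.ofReal_le_ofReal (htail N)

lemma rpow_le_one_add_rpow {x γ q : ℝ} (hx : 0 ≤ x) (hγ : 0 ≤ γ) (hγq : γ ≤ q) :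
    x ^ γ ≤ 1 + x ^ q := by
  rcases le_total x 1 with h | h
  · exact (Real.rpow_le_one hx h hγ).trans (le_add_of_nonneg_right (by positivity))
  · exact (Real.rpow_le_rpow_of_exponent_le h hγq).trans (le_add_of_nonneg_left zero_le_one)

lemma one_div_one_add_rpow_le {T j q β γ : ℝ} (hT : 0 < T) (hj : 1 ≤ j) (hγ : 0 ≤ γ)
    (hγβ : γ ≤ β) (hγq : γ ≤ q) : 1 / (1 + (T / j) ^ q) ≤ T ^ (-γ) * j ^ β := by
  have hj₀ : 0 < j := one_pos.trans_le hj
  rw [div_le_iff₀ (by positivity), Real.rpow_neg hT.le, mul_assoc, ← div_eq_inv_mul,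
    one_le_div (by positivity)]
  calc T ^ γ = j ^ γ * (T / j) ^ γ := by
        rw [← Real.mul_rpow hj₀.le (by positivity), mul_div_cancel₀ T hj₀.ne']
    _ ≤ j ^ β * (1 + (T / j) ^ q) := by
        gcongr
        exact rpow_le_one_add_rpow (by positivity) hγ hγq

variable {L T q : ℝ} {w : ℕ → ℝ}

lemma tsum_bias_sq_le {β γ : ℝ} (hT : 0 < T) (hγ : 0 ≤ γ) (hγβ : γ ≤ β) (hγq : γ ≤ q)
    (hL : 0 ≤ L) (hw₀ : ∀ i, 0 ≤ w i)
    (hw : ∀ i : ℕ, w i ≤ L / (1 + (T / ((i : ℝ) + 1)) ^ q)) (f : ℕ → ℝ) :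
    ∑' i, ENNReal.ofReal ((w i * f i) ^ 2) ≤
      ENNReal.ofReal (L * T ^ (-γ)) ^ 2 * sobolevNorm β f ^ 2 := by
  rw [sobolevNorm_sq, ← ENNReal.tsum_mul_left, ← ENNReal.ofReal_pow (by positivity)]
  refine ENNReal.tsum_le_tsum fun i => ?_
  have hwi : w i ≤ L * (T ^ (-γ) * ((i : ℝ) + 1) ^ β) := by
    refine (hw i).trans ?_
    rw [div_eq_mul_one_div]
    gcongr
    exact one_div_one_add_rpow_le hT (by simp) hγ hγβ hγq
  rw [← ENNReal.ofReal_mul (by positivity)]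
  refine ENNReal.ofReal_le_ofReal ?_
  calc (w i * f i) ^ 2 = w i ^ 2 * f i ^ 2 := mul_pow _ _ _
    _ ≤ (L * (T ^ (-γ) * ((i : ℝ) + 1) ^ β)) ^ 2 * f i ^ 2 := by gcongr; exact hw₀ i
    _ = (L * T ^ (-γ)) ^ 2 * (f i ^ 2 * ((i : ℝ) + 1) ^ (2 * β)) := by
        rw [mul_comm 2 β, Real.rpow_mul (by positivity), Real.rpow_two]
        ring

lemma tsum_variance_le {α : ℝ} (hα : 0 < α) (hT : 1 ≤ T) (hq : 1 + 2 * α ≤ q) (hL : 0 ≤ L)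
    (hw : ∀ i : ℕ, w i ≤ L / (1 + (T / ((i : ℝ) + 1)) ^ q)) :
    ∑' i, ENNReal.ofReal (w i * priorSd α i ^ 2) ≤
      ENNReal.ofReal (L * ((1 + 2 ^ (2 * α) / (2 * α)) * T ^ (-(2 * α)))) := by
  rw [ENNReal.ofReal_mul hL]
  refine le_trans ?_ (mul_le_mul_right (tsum_rpow_div_one_add_le (by positivity) hq hT) _)
  rw [← ENNReal.tsum_mul_left]
  refine ENNReal.tsum_le_tsum fun i => ?_
  rw [← ENNReal.ofReal_mul hL, priorSd_sq, mul_div_left_comm, mul_comm]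
  gcongr
  exact hw i

end Rates

section Contraction

/-- The effective dimension `n^{1/(1+2α+2p)}`: the index up to which the signal-to-noise ratio of
the coordinates exceeds a constant, in the model with `κ_i ≍ i^{-p}` and prior variances
`i^{-1-2α}`. -/
noncomputable def effectiveDim (α p : ℝ) (n : ℕ) : ℝ := (n : ℝ) ^ (1 / (1 + 2 * α + 2 * p))

variable {p α β C : ℝ} {κ : ℕ → ℝ} {n : ℕ}

lemma one_le_effectiveDim (hp : 0 ≤ p) (hα : 0 < α) (hn : 0 < n) : 1 ≤ effectiveDim α p n :=
  Real.one_le_rpow (by exact_mod_cast hn) (by positivity)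

lemma abs_le_of_rpow_bounds (hp : 0 ≤ p) (hC : 0 ≤ C)
    (hκ : ∀ i : ℕ, C⁻¹ * ((i : ℝ) + 1) ^ (-p) ≤ κ i ∧ κ i ≤ C * ((i : ℝ) + 1) ^ (-p)) (i : ℕ) :
    |κ i| ≤ C :=
  calc |κ i| = κ i := abs_of_nonneg (le_trans (by positivity) (hκ i).1)
    _ ≤ C * ((i : ℝ) + 1) ^ (-p) := (hκ i).2
    _ ≤ C := mul_le_of_le_one_right hC
        (Real.rpow_le_one_of_one_le_of_nonpos (by simp) (neg_nonpos.2 hp))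

lemma effectiveDim_div_rpow_le (hp : 0 ≤ p) (hα : 0 < α)
    (hκ : ∀ i : ℕ, ((i : ℝ) + 1) ^ (-p) ≤ C * |κ i|) (i : ℕ) :
    (effectiveDim α p n / ((i : ℝ) + 1)) ^ (1 + 2 * α + 2 * p) ≤
      C ^ 2 * (√(n : ℝ) * (κ i * priorSd α i)) ^ 2 := by
  have hj : (0 : ℝ) < (i : ℝ) + 1 := by positivity
  calc (effectiveDim α p n / ((i : ℝ) + 1)) ^ (1 + 2 * α + 2 * p)
      = n * (((i : ℝ) + 1) ^ (-p)) ^ 2 * priorSd α i ^ 2 := by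
        rw [effectiveDim, Real.div_rpow (by positivity) hj.le, ← Real.rpow_mul (by positivity),
          one_div_mul_cancel (by positivity), Real.rpow_one, priorSd_sq, ← Real.rpow_two,
          ← Real.rpow_mul hj.le, mul_assoc, ← Real.rpow_add hj, div_eq_mul_inv,
          ← Real.rpow_neg hj.le]
        ring_nf
    _ ≤ n * (C * |κ i|) ^ 2 * priorSd α i ^ 2 := by gcongr; exact hκ i
    _ = C ^ 2 * (√(n : ℝ) * (κ i * priorSd α i)) ^ 2 := by
        rw [mul_pow C, sq_abs, mul_pow (√(n : ℝ)), Real.sq_sqrt n.cast_nonneg]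
        ring

lemma cos_signalAngle_sq_le (hp : 0 ≤ p) (hα : 0 < α)
    (hκ : ∀ i : ℕ, ((i : ℝ) + 1) ^ (-p) ≤ C * |κ i|) (i : ℕ) :
    Real.cos (signalAngle κ (priorSd α) n i) ^ 2 ≤
      (1 + C ^ 2) / (1 + (effectiveDim α p n / ((i : ℝ) + 1)) ^ (1 + 2 * α + 2 * p)) := by
  have hsignal := effectiveDim_div_rpow_le (n := n) hp hα hκ i
  have hdim : 0 ≤ effectiveDim α p n := Real.rpow_nonneg n.cast_nonneg _
  rw [signalAngle, Real.cos_sq_arctan, div_le_div_iff₀ (by positivity) (by positivity), one_mul]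
  linarith [sq_nonneg C, sq_nonneg (√(n : ℝ) * (κ i * priorSd α i))]

/-- The constant in front of the squared contraction rate in the posterior risk bound over a Sobolev
ball of radius `R`. -/
noncomputable def riskConstant (α C R : ℝ) : ℝ≥0∞ :=
  ENNReal.ofReal (1 + C ^ 2) ^ 2 * ENNReal.ofReal R ^ 2 +
    2 * ENNReal.ofReal ((1 + C ^ 2) * (1 + 2 ^ (2 * α) / (2 * α)))

lemma riskConstant_ne_top (α C R : ℝ) : riskConstant α C R ≠ ∞ := by
  unfold riskConstant; finiteness

theorem tsum_bias_sq_add_variance_le {R : ℝ} (hp : 0 ≤ p) (hα : 0 < α) (hβ : 0 ≤ β) (hn : 0 < n)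
    (hκ : ∀ i : ℕ, ((i : ℝ) + 1) ^ (-p) ≤ C * |κ i|) {f₀ : ℕ → ℝ}
    (hf₀ : sobolevNorm β f₀ ≤ ENNReal.ofReal R) :
    ∑' i, ENNReal.ofReal ((Real.cos (signalAngle κ (priorSd α) n i) ^ 2 * f₀ i) ^ 2) +
        2 * ∑' i, ENNReal.ofReal
          (Real.cos (signalAngle κ (priorSd α) n i) ^ 2 * priorSd α i ^ 2) ≤
      riskConstant α C R * ENNReal.ofReal (effectiveDim α p n ^ (-min α β)) ^ 2 := by
  set T := effectiveDim α p n
  have hT : 1 ≤ T := one_le_effectiveDim hp hα hn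
  have hT₀ : 0 < T := one_pos.trans_le hT
  have hL : 0 ≤ 1 + C ^ 2 := by positivity
  have hw := cos_signalAngle_sq_le (n := n) hp hα hκ
  have hbias := tsum_bias_sq_le hT₀ (le_min hα.le hβ) (min_le_right α β)
    ((min_le_left α β).trans (by linarith)) hL (fun _ => sq_nonneg _) hw f₀
  have hvariance := tsum_variance_le hα hT (by linarith) hL hw
  have hrate : T ^ (-(2 * α)) ≤ (T ^ (-min α β)) ^ 2 := by
    rw [← Real.rpow_two, ← Real.rpow_mul hT₀.le]
    exact Real.rpow_le_rpow_of_exponent_le hT (by linarith [min_le_left α β])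
  calc _ ≤ ENNReal.ofReal ((1 + C ^ 2) * T ^ (-min α β)) ^ 2 * ENNReal.ofReal R ^ 2 +
        2 * ENNReal.ofReal ((1 + C ^ 2) *
          ((1 + 2 ^ (2 * α) / (2 * α)) * (T ^ (-min α β)) ^ 2)) := by
        refine add_le_add (hbias.trans ?_) (mul_le_mul_right (hvariance.trans ?_) 2) <;> gcongr
    _ = riskConstant α C R * ENNReal.ofReal (T ^ (-min α β)) ^ 2 := by
        rw [riskConstant, ← mul_assoc (1 + C ^ 2), ENNReal.ofReal_mul hL,
          ENNReal.ofReal_mul (by positivity), ENNReal.ofReal_pow (by positivity)]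
        ring

theorem lintegral_posterior_ge_rate_le {B R : ℝ} (hp : 0 ≤ p) (hα : 0 < α) (hβ : 0 ≤ β)
    (hn : 0 < n) (hκ : ∀ i : ℕ, ((i : ℝ) + 1) ^ (-p) ≤ C * |κ i|) (hκB : ∀ i, |κ i| ≤ B)
    {post : Kernel (ℕ → ℝ) (ℕ → ℝ)} [IsFiniteKernel post]
    (hpost : IsPosterior (prior α) (sampleLaw κ n) post) {f₀ : ℕ → ℝ} (hf₀ : f₀ ∈ sobolevBall β R)
    {M : ℝ} (hM : 0 < M) :
    ∫⁻ Y, post Y {f | ENNReal.ofReal (M * (n : ℝ) ^ (-(min α β) / (1 + 2 * α + 2 * p)))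
        ≤ ell2Norm (f - f₀)} ∂sampleLaw κ n f₀ ≤
      riskConstant α C R / ENNReal.ofReal M ^ 2 := by
  have hrate : (n : ℝ) ^ (-(min α β) / (1 + 2 * α + 2 * p)) =
      effectiveDim α p n ^ (-min α β) := by
    rw [effectiveDim, ← Real.rpow_mul n.cast_nonneg]
    ring_nf
  have hrate₀ : 0 < effectiveDim α p n ^ (-min α β) :=
    Real.rpow_pos_of_pos (one_pos.trans_le (one_le_effectiveDim hp hα hn)) _
  rw [prior_eq_scaledNoise] at hpost
  rw [hrate]
  refine (lintegral_posterior_le hn hκB (summable_priorSd_sq hα) hf₀.1.1.ne hpost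
    (ENNReal.ofReal_pos.2 (mul_pos hM hrate₀)).ne' ENNReal.ofReal_ne_top).trans ?_
  rw [ENNReal.ofReal_mul hM.le, mul_pow]
  refine (ENNReal.div_le_div_right (tsum_bias_sq_add_variance_le hp hα hβ hn hκ hf₀.2) _).trans_eq
    (ENNReal.mul_div_mul_right _ _ ?_ (by finiteness))
  exact pow_ne_zero 2 (ENNReal.ofReal_pos.2 hrate₀).ne'

end Contraction

end SeqModel

theorem theorem3p1_general {p α β B C R : ℝ} (hp : 0 ≤ p) (hα : 0 < α) (hβ : 0 ≤ β) {κ : ℕ → ℝ}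
    (hκ : ∀ i : ℕ, ((i : ℝ) + 1) ^ (-p) ≤ C * |κ i|) (hκB : ∀ i, |κ i| ≤ B)
    {post : ℕ → Kernel (ℕ → ℝ) (ℕ → ℝ)} [∀ n, IsFiniteKernel (post n)]
    (hpost : ∀ n : ℕ, 1 ≤ n →
      SeqModel.IsPosterior (SeqModel.prior α) (SeqModel.sampleLaw κ n) (post n))
    {M : ℕ → ℝ} (hM : Tendsto M atTop atTop) :
    Tendsto
      (fun n : ℕ => ⨆ f₀ ∈ SeqModel.sobolevBall β R,
        ∫⁻ Y, post n Y
            {f | ENNReal.ofReal (M n * (n : ℝ) ^ (-(min α β) / (1 + 2 * α + 2 * p)))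
                  ≤ SeqModel.ell2Norm (f - f₀)}
          ∂(SeqModel.sampleLaw κ n f₀))
      atTop (𝓝 0) := by
  have hbound : Tendsto (fun n => SeqModel.riskConstant α C R / ENNReal.ofReal (M n) ^ 2)
      atTop (𝓝 0) := by
    have hM_sq : Tendsto (fun n => ENNReal.ofReal (M n) ^ 2) atTop (𝓝 ∞) := by
      simpa [Function.comp_def] using ((ENNReal.continuous_pow 2).tendsto ∞).comp
        (ENNReal.tendsto_ofReal_atTop.comp hM)
    simpa using ENNReal.Tendsto.const_div hM_sq (Or.inr (SeqModel.riskConstant_ne_top α C R))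
  refine tendsto_of_tendsto_of_tendsto_of_le_of_le' tendsto_const_nhds hbound
    (Eventually.of_forall fun _ => zero_le) ?_
  filter_upwards [hM.eventually_gt_atTop 0, eventually_ge_atTop 1] with n hMn hn
  exact iSup₂_le fun f₀ hf₀ =>
    SeqModel.lintegral_posterior_ge_rate_le hp hα hβ hn hκ hκB (hpost n hn) hf₀ hMn

theorem theorem3p1
    (p C α β R : ℝ) (hp : 0 ≤ p) (hC : 1 ≤ C) (hα : 0 < α) (hβ : 0 < β) (hR : 0 < R)
    (κ : ℕ → ℝ)
    (hκ : ∀ i : ℕ, C⁻¹ * ((i : ℝ) + 1) ^ (-p) ≤ κ i ∧ κ i ≤ C * ((i : ℝ) + 1) ^ (-p))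
    (post : ℕ → Kernel (ℕ → ℝ) (ℕ → ℝ)) [∀ n, IsMarkovKernel (post n)]
    (hpost : ∀ n : ℕ, 1 ≤ n →
      SeqModel.IsPosterior (SeqModel.prior α) (SeqModel.sampleLaw κ n) (post n))
    (M : ℕ → ℝ) (hM : Tendsto M atTop atTop) :
    Tendsto
      (fun n : ℕ => ⨆ f₀ ∈ SeqModel.sobolevBall β R,
        ∫⁻ Y, post n Y
            {f | ENNReal.ofReal (M n * (n : ℝ) ^ (-(min α β) / (1 + 2 * α + 2 * p)))
                  ≤ SeqModel.ell2Norm (f - f₀)}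
          ∂(SeqModel.sampleLaw κ n f₀))
      atTop (𝓝 0) :=
  theorem3p1_general hp hα hβ.le (fun i =>
      (inv_mul_le_iff₀ (one_pos.trans_le hC)).1 ((hκ i).1.trans (le_abs_self _)))
    (SeqModel.abs_le_of_rpow_bounds hp (zero_le_one.trans hC) hκ) hpost hM
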